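/- Let $N\ge 1$, let $y_1,\dots,y_N\in\mathbb{R}$ (in the application, the sampled Bellman targets $y_j=r+\gamma Z_{\tau'_j}(s',a')$), and let $\hat\mu=\frac1N\sum_{j=1}^N\delta_{y_j}$ be their empirical law. Let $\tau\in(0,1)$, $\epsilon\ge 0$, $p\in(1,\infty]$, and let $q\in[1,\infty)$ be the conjugate exponent, $\frac1p+\frac1q=1$ (so $q=1$ if $p=\infty$). Let $\rho_\tau(u)=u(\tau-\mathbf 1_{\{u<0\}})$ be the check loss. Let $W_p(\nu,\mu)=\inf_\pi \|X-Y\|_{L^p(\pi)}$, the infimum being over all couplings $\pi$ (laws of pairs $(X,Y)$ with $X\sim\nu$, $Y\sim\mu$), with the essential supremum norm for $p=\infty$, and let $B_p(\hat\mu,\epsilon)=\{\nu\in\mathcal P(\mathbb R): W_p(\nu,\hat\mu)\le\epsilon\}$, where $\mathcal P(\mathbb R)$ is the set of Borel probability measures on $\mathbb{R}$. Put $$\Delta_p(\tau,\epsilon)=\frac{\epsilon}{q}\bigl(\tau^q-(1-\tau)^q\bigr)\,c_{\tau,p}^{\,1-q},\qquad c_{\tau,p}=\begin{cases}\bigl(\tau^q(1-\tau)+\tau(1-\tau)^q\bigr)^{1/q},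 & p\in(1,\infty),\\ 2\tau(1-\tau), & p=\infty.\end{cases}$$ Then the robust quantile estimation problem $$\min_{x\in\mathbb R}\ \sup_{\nu\in B_p(\hat\mu,\epsilon)}\mathbb E_{Y\sim\nu}\bigl[\rho_\tau(Y-x)\bigr]$$ has a minimizer, and a real number $x$ is a minimizer of it if and only if $x=x^0+\Delta_p(\tau,\epsilon)$ for some nominal empirical $\tau$-quantile $x^0\in\arg\min_{x'\in\mathbb R}\mathbb E_{Y\sim\hat\mu}[\rho_\tau(Y-x')]$. -/

import Mathlib

open MeasureTheory
open scoped ENNReal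

noncomputable section

/-- The check (quantile) loss `ρ_τ(u) = u (τ - 1_{u < 0})`. -/
def checkLoss (τ u : ℝ) : ℝ := u * (τ - if u < 0 then 1 else 0)

/-- The empirical law `(1/N) ∑ j, δ_{y j}` of the sampled targets `y j`. -/
def empiricalLaw {N : ℕ} (y : Fin N → ℝ) : Measure ℝ :=
  (N : ℝ≥0∞)⁻¹ • ∑ j, Measure.dirac (y j)

/-- `π` is a coupling of `ν` and `μ`. -/
def IsCoupling (π : Measure (ℝ × ℝ)) (ν μ : Measure ℝ) : Prop :=
  π.fst = ν ∧ π.snd = μ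

/-- The type-`p` Wasserstein distance on `ℝ`: the infimum over all couplings of the `L^p` norm of
the displacement (the essential supremum of `|x - y|` when `p = ∞`). -/
def wassersteinDist (p : ℝ≥0∞) (ν μ : Measure ℝ) : ℝ≥0∞ :=
  ⨅ (π : Measure (ℝ × ℝ)) (_ : IsCoupling π ν μ), eLpNorm (fun z : ℝ × ℝ => z.1 - z.2) p π

/-- The type-`p` Wasserstein ambiguity set: all Borel probability measures on `ℝ` within
distance `ε` of `μ`. -/
def wassersteinBall (p : ℝ≥0∞) (μ : Measure ℝ) (ε : ℝ) : Set (Measure ℝ) :=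
  {ν | IsProbabilityMeasure ν ∧ wassersteinDist p ν μ ≤ ENNReal.ofReal ε}

/-- `E_{Y ∼ ν} [ρ_τ (Y - q)]`, as an element of `[0, ∞]`; the loss is nonnegative for
`τ ∈ [0, 1]`. -/
def expectedCheckLoss (τ : ℝ) (ν : Measure ℝ) (q : ℝ) : ℝ≥0∞ :=
  ∫⁻ Y, ENNReal.ofReal (checkLoss τ (Y - q)) ∂ν

/-- The worst-case expected check loss over the Wasserstein ambiguity set. -/
def robustCheckLoss (p : ℝ≥0∞) (τ ε : ℝ) (μ : Measure ℝ) (q : ℝ) : ℝ≥0∞ :=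
  ⨆ ν ∈ wassersteinBall p μ ε, expectedCheckLoss τ ν q

/-- The set of minimizers over `ℝ` of an objective. -/
def argminSet (F : ℝ → ℝ≥0∞) : Set ℝ := {x | IsMinOn F Set.univ x}

/-- The constant `c_{τ,p}`; `q` is the conjugate exponent of `p`. -/
def correctionConst (p q : ℝ≥0∞) (τ : ℝ) : ℝ :=
  if p = ∞ then 2 * τ * (1 - τ)
  else (τ ^ q.toReal * (1 - τ) + τ * (1 - τ) ^ q.toReal) ^ (1 / q.toReal)

/-- The location correction `Δ_p(τ, ε)`; `q` is the conjugate exponent of `p`. -/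
def locationCorrection (p q : ℝ≥0∞) (τ ε : ℝ) : ℝ :=
  ε / q.toReal * (τ ^ q.toReal - (1 - τ) ^ q.toReal) *
    correctionConst p q τ ^ (1 - q.toReal)

end

/-! The check loss is the larger of two lines, of slopes `τ` and `τ - 1`. Choosing the slope at
random, `τ` with probability `a j` given the sample point `y j`, bounds it from below with mean
slope `a j - (1 - τ)`. Write `r` for the real conjugate exponent, `α` for the mean of `a`, and `H α
= α τ^r + (1 - α) (1 - τ)^r`. Displacing the sample as in the equality case of Hölder gives the
lower bound `mean ((a - (1 - τ)) (y - x)) + ε (H α)^(1/r)` on the robust loss at `x`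
(`le_robustCheckLoss`).

If `α = 1 - τ`, this bound does not involve `x`. With `a` certifying a sample quantile it equals the
nominal minimum plus `ε c`, where `c = H (1 - τ) ^ (1/r)`. Conversely, let `s` be the derivative of
`H^(1/r)` at `1 - τ`. Subadditivity of the check loss and Young's inequality give robust loss at `x₀
+ ε s` at most nominal loss at `x₀` plus `ε c` (`robustCheckLoss_add_correction_le`), so shifted
quantiles are optimal.

For uniqueness up to quantiles, perturb `a` in the lower bound at an optimal `x`. The first-order
condition says exactly that `x - ε s` minimizes the nominal loss
(`sampleCheckLoss_sub_correction_le`). -/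

/-! ### The check loss and its sample mean -/

theorem checkLoss_eq_max (τ u : ℝ) : checkLoss τ u = max (τ * u) ((τ - 1) * u) := by
  unfold checkLoss
  split_ifs with h
  · rw [max_eq_right (by linarith)]; ring
  · rw [max_eq_left (by linarith)]; ring

theorem mul_le_checkLoss (τ u : ℝ) : τ * u ≤ checkLoss τ u :=
  (le_max_left _ _).trans_eq (checkLoss_eq_max τ u).symm

theorem sub_one_mul_le_checkLoss (τ u : ℝ) : (τ - 1) * u ≤ checkLoss τ u :=
  (le_max_right _ _).trans_eq (checkLoss_eq_max τ u).symm

theorem checkLoss_le_iff {τ u b : ℝ} : checkLoss τ u ≤ b ↔ τ * u ≤ b ∧ (τ - 1) * u ≤ b := by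
  rw [checkLoss_eq_max, max_le_iff]

theorem convexCombination_mul_le_checkLoss {τ a : ℝ} (h0 : 0 ≤ a) (h1 : a ≤ 1) (u : ℝ) :
    (a - (1 - τ)) * u ≤ checkLoss τ u := by
  nlinarith [mul_le_mul_of_nonneg_left (mul_le_checkLoss τ u) h0,
    mul_le_mul_of_nonneg_left (sub_one_mul_le_checkLoss τ u) (sub_nonneg.2 h1)]

theorem checkLoss_nonneg {τ : ℝ} (h0 : 0 ≤ τ) (h1 : τ ≤ 1) (u : ℝ) : 0 ≤ checkLoss τ u := by
  have := convexCombination_mul_le_checkLoss (τ := τ) (sub_nonneg.2 h1) (by linarith) u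
  simpa using this

theorem checkLoss_add_le (τ u v : ℝ) : checkLoss τ (u + v) ≤ checkLoss τ u + checkLoss τ v := by
  rw [checkLoss_le_iff]
  constructor
  · linarith [mul_le_checkLoss τ u, mul_le_checkLoss τ v]
  · linarith [sub_one_mul_le_checkLoss τ u, sub_one_mul_le_checkLoss τ v]

theorem checkLoss_mul {k : ℝ} (hk : 0 ≤ k) (τ u : ℝ) :
    checkLoss τ (k * u) = k * checkLoss τ u := by
  rw [checkLoss_eq_max, checkLoss_eq_max, mul_max_of_nonneg _ _ hk]
  congr 1 <;> ring

theorem checkLoss_le_abs {τ : ℝ} (h0 : 0 ≤ τ) (h1 : τ ≤ 1) (u : ℝ) : checkLoss τ u ≤ |u| := by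
  rw [checkLoss_le_iff]
  constructor <;> nlinarith [le_abs_self u, neg_abs_le u, abs_nonneg u]

theorem measurable_checkLoss (τ : ℝ) : Measurable (checkLoss τ) := by
  have : checkLoss τ = fun u => max (τ * u) ((τ - 1) * u) := funext (checkLoss_eq_max τ)
  rw [this]
  fun_prop

theorem measurable_ofReal_checkLoss_sub (τ x : ℝ) :
    Measurable fun Y => ENNReal.ofReal (checkLoss τ (Y - x)) :=
  ((measurable_checkLoss τ).comp (measurable_id.sub_const x)).ennreal_ofReal

theorem checkLoss_eq_indicator (τ u : ℝ) :
    checkLoss τ u = ((if 0 ≤ u then 1 else 0) - (1 - τ)) * u := by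
  unfold checkLoss
  by_cases h : u < 0
  · rw [if_pos h, if_neg (not_le.2 h)]; ring
  · rw [if_neg h, if_pos (not_lt.1 h)]; ring

/-- The average check loss of the sample `y` at `x`. -/
noncomputable def sampleCheckLoss {N : ℕ} (y : Fin N → ℝ) (τ x : ℝ) : ℝ :=
  (∑ j, checkLoss τ (y j - x)) / N

theorem expectedCheckLoss_empiricalLaw {N : ℕ} (hN : 0 < N) (y : Fin N → ℝ) {τ : ℝ}
    (h0 : 0 ≤ τ) (h1 : τ ≤ 1) (x : ℝ) :
    expectedCheckLoss τ (empiricalLaw y) x = ENNReal.ofReal (sampleCheckLoss y τ x) := by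
  unfold expectedCheckLoss empiricalLaw sampleCheckLoss
  rw [lintegral_smul_measure, lintegral_finsetSum_measure]
  simp only [lintegral_dirac]
  rw [ENNReal.ofReal_div_of_pos (by exact_mod_cast hN),
    ENNReal.ofReal_sum_of_nonneg fun j _ => checkLoss_nonneg h0 h1 _, ENNReal.ofReal_natCast,
    ENNReal.div_eq_inv_mul, smul_eq_mul]

/-! ### Two-point displacements and the lower bound -/

/-- The `r`-th moment of a random slope equal to `τ` with probability `α` and to `τ - 1`
otherwise. -/
noncomputable def slopeMoment (τ r α : ℝ) : ℝ := α * τ ^ r + (1 - α) * (1 - τ) ^ r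

theorem slopeMoment_pos {τ : ℝ} (hτ : τ ∈ Set.Ioo (0 : ℝ) 1) (r : ℝ) {α : ℝ} (h0 : 0 ≤ α)
    (h1 : α ≤ 1) : 0 < slopeMoment τ r α := by
  have ht := Real.rpow_pos_of_pos hτ.1 r
  have ht' := Real.rpow_pos_of_pos (sub_pos.2 hτ.2) r
  unfold slopeMoment
  rcases h0.eq_or_lt with rfl | h
  · simpa using ht'
  · have := mul_pos h ht
    have := mul_nonneg (sub_nonneg.2 h1) ht'.le
    linarith

/-- The law of `(y j + D, y j)`, where `j` is uniform and, given `j`, the displacement `D` is `u`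
with probability `a j` and `-v` otherwise. -/
noncomputable def displacementCoupling {N : ℕ} (y a : Fin N → ℝ) (u v : ℝ) : Measure (ℝ × ℝ) :=
  ∑ j, (ENNReal.ofReal (a j / N) • Measure.dirac (y j + u, y j) +
    ENNReal.ofReal ((1 - a j) / N) • Measure.dirac (y j - v, y j))

theorem lintegral_displacementCoupling {N : ℕ} (y : Fin N → ℝ) {a : Fin N → ℝ}
    (h0 : ∀ j, 0 ≤ a j) (h1 : ∀ j, a j ≤ 1) (u v : ℝ) {g : ℝ × ℝ → ℝ} (hg : ∀ z, 0 ≤ g z) :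
    ∫⁻ z, ENNReal.ofReal (g z) ∂(displacementCoupling y a u v) =
      ENNReal.ofReal
        ((∑ j, (a j * g (y j + u, y j) + (1 - a j) * g (y j - v, y j))) / N) := by
  unfold displacementCoupling
  rw [lintegral_finsetSum_measure, Finset.sum_div, ENNReal.ofReal_sum_of_nonneg]
  · refine Finset.sum_congr rfl fun j _ => ?_
    have hj := sub_nonneg.2 (h1 j)
    have hj0 := h0 j
    have := hg (y j + u, y j)
    have := hg (y j - v, y j)
    rw [lintegral_add_measure, lintegral_smul_measure, lintegral_smul_measure, lintegral_dirac,
      lintegral_dirac, smul_eq_mul, smul_eq_mul, ← ENNReal.ofReal_mul (by positivity),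
      ← ENNReal.ofReal_mul (by positivity), ← ENNReal.ofReal_add (by positivity) (by positivity)]
    congr 1
    ring
  · intro j _
    have hj := sub_nonneg.2 (h1 j)
    have hj0 := h0 j
    have := hg (y j + u, y j)
    have := hg (y j - v, y j)
    positivity

theorem displacementCoupling_snd {N : ℕ} (hN : 0 < N) (y : Fin N → ℝ) {a : Fin N → ℝ}
    (h0 : ∀ j, 0 ≤ a j) (h1 : ∀ j, a j ≤ 1) (u v : ℝ) :
    (displacementCoupling y a u v).snd = empiricalLaw y := by
  ext s hs
  rw [Measure.snd_apply hs]
  have hm : MeasurableSet (Prod.snd ⁻¹' s : Set (ℝ × ℝ)) := measurable_snd hs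
  have key (j) : ENNReal.ofReal (a j / N) + ENNReal.ofReal ((1 - a j) / N) = (N : ℝ≥0∞)⁻¹ := by
    have hj := sub_nonneg.2 (h1 j)
    have hj0 := h0 j
    rw [← ENNReal.ofReal_add (by positivity) (by positivity), ← add_div, add_sub_cancel, one_div,
      ENNReal.ofReal_inv_of_pos (by exact_mod_cast hN), ENNReal.ofReal_natCast]
  simp only [displacementCoupling, empiricalLaw, Measure.coe_finsetSum, Finset.sum_apply,
    Measure.add_apply, Measure.smul_apply, smul_eq_mul, Measure.dirac_apply' _ hm,
    Measure.dirac_apply' _ hs, Finset.mul_sum]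
  refine Finset.sum_congr rfl fun j _ => ?_
  rw [← key j, add_mul]
  rfl

theorem ae_displacementCoupling {N : ℕ} (y a : Fin N → ℝ) (u v : ℝ) :
    ∀ᵐ z ∂(displacementCoupling y a u v), z.1 - z.2 = u ∨ z.1 - z.2 = -v := by
  rw [ae_iff]
  simp [displacementCoupling, Measure.dirac_apply]

theorem isProbabilityMeasure_empiricalLaw {N : ℕ} (hN : 0 < N) (y : Fin N → ℝ) :
    IsProbabilityMeasure (empiricalLaw y) := by
  constructor
  have : (N : ℝ≥0∞) ≠ 0 := by exact_mod_cast hN.ne'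
  simp [empiricalLaw, ENNReal.inv_mul_cancel this]

theorem isProbabilityMeasure_of_snd {π : Measure (ℝ × ℝ)} {μ : Measure ℝ}
    [IsProbabilityMeasure μ] (h : π.snd = μ) : IsProbabilityMeasure π := by
  constructor
  rw [← Measure.snd_univ, h, measure_univ]

theorem eLpNorm_le_ofReal_iff {α : Type*} [MeasurableSpace α] {μ : Measure α} {p : ℝ≥0∞}
    (hp0 : p ≠ 0) (hp : p ≠ ∞) {f : α → ℝ} {ε : ℝ} (hε : 0 ≤ ε) :
    eLpNorm f p μ ≤ ENNReal.ofReal ε ↔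
      ∫⁻ z, ENNReal.ofReal (|f z| ^ p.toReal) ∂μ ≤ ENNReal.ofReal (ε ^ p.toReal) := by
  have hP := ENNReal.toReal_pos hp0 hp
  rw [eLpNorm_eq_lintegral_rpow_enorm_toReal hp0 hp, one_div, ENNReal.rpow_inv_le_iff hP,
    ENNReal.ofReal_rpow_of_nonneg hε hP.le]
  simp_rw [← ofReal_norm, Real.norm_eq_abs,
    ENNReal.ofReal_rpow_of_nonneg (abs_nonneg _) hP.le]

theorem eq_top_or_holderConjugate {p q : ℝ≥0∞} (hp : 1 < p) (hpq : 1 / p + 1 / q = 1) :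
    (p = ∞ ∧ q.toReal = 1) ∨ (p ≠ ∞ ∧ p.toReal.HolderConjugate q.toReal) := by
  by_cases h : p = ∞
  · left
    refine ⟨h, ?_⟩
    rw [h, one_div, one_div, ENNReal.inv_top, zero_add, ENNReal.inv_eq_one] at hpq
    simp [hpq]
  · right
    refine ⟨h, ?_⟩
    have hp0 : p ≠ 0 := (zero_lt_one.trans hp).ne'
    rw [Real.holderConjugate_iff]
    refine ⟨by simpa using (ENNReal.toReal_lt_toReal ENNReal.one_ne_top h).2 hp, ?_⟩
    rw [one_div, one_div] at hpq
    have hq : q⁻¹ ≠ ∞ := fun hq => by simp [hq] at hpq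
    rw [← ENNReal.toReal_inv, ← ENNReal.toReal_inv, ← ENNReal.toReal_add (by simpa using hp0) hq,
      hpq, ENNReal.toReal_one]

/-- Hölder's equality case: displacement sizes are proportional to `|slope| ^ (r - 1)`, and the
power of `slopeMoment` normalizes their `L^P` norm to `ε`. -/
theorem displacement_moment {P r τ α ε : ℝ} (h : P.HolderConjugate r) (hτ : τ ∈ Set.Ioo (0 : ℝ) 1)
    (hε : 0 ≤ ε) (h0 : 0 ≤ α) (h1 : α ≤ 1) :
    α * |ε * τ ^ (r - 1) * slopeMoment τ r α ^ (1 / r - 1)| ^ P +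
      (1 - α) * |ε * (1 - τ) ^ (r - 1) * slopeMoment τ r α ^ (1 / r - 1)| ^ P = ε ^ P := by
  have hH := slopeMoment_pos hτ r h0 h1
  have hτ' := sub_pos.2 hτ.2
  have e1 : (r - 1) * P = r := by
    have := h.symm.sub_one_mul_conj
    linarith
  have e2 : (1 / r - 1) * P = -1 := by
    have := h.inv_add_inv_eq_one
    have hP := h.pos.ne'
    have : 1 / r - 1 = -P⁻¹ := by rw [one_div]; linarith
    rw [this, neg_mul, inv_mul_cancel₀ hP]
  have key (t : ℝ) (ht : 0 < t) :
      |ε * t ^ (r - 1) * slopeMoment τ r α ^ (1 / r - 1)| ^ P =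
        ε ^ P * (t ^ r / slopeMoment τ r α) := by
    rw [abs_of_nonneg (by positivity), Real.mul_rpow (by positivity) (by positivity),
      Real.mul_rpow hε (by positivity), ← Real.rpow_mul ht.le, ← Real.rpow_mul hH.le, e1, e2,
      Real.rpow_neg_one]
    ring
  rw [key τ hτ.1, key _ hτ']
  have : slopeMoment τ r α = α * τ ^ r + (1 - α) * (1 - τ) ^ r := rfl
  calc _ = ε ^ P * ((α * τ ^ r + (1 - α) * (1 - τ) ^ r) / slopeMoment τ r α) := by ring
    _ = ε ^ P := by rw [← this, div_self hH.ne', mul_one]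

theorem displacement_gain {r τ α : ℝ} (hτ : τ ∈ Set.Ioo (0 : ℝ) 1) (ε : ℝ)
    (h0 : 0 ≤ α) (h1 : α ≤ 1) :
    α * (τ * (ε * τ ^ (r - 1) * slopeMoment τ r α ^ (1 / r - 1))) +
      (1 - α) * ((1 - τ) * (ε * (1 - τ) ^ (r - 1) * slopeMoment τ r α ^ (1 / r - 1))) =
        ε * slopeMoment τ r α ^ (1 / r) := by
  have hH := slopeMoment_pos hτ r h0 h1
  have key (t : ℝ) (ht : 0 < t) : t * t ^ (r - 1) = t ^ r := by
    rw [Real.rpow_sub_one ht.ne']; field_simp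
  have hs : slopeMoment τ r α = α * τ ^ r + (1 - α) * (1 - τ) ^ r := rfl
  calc _ = ε * ((α * (τ * τ ^ (r - 1)) + (1 - α) * ((1 - τ) * (1 - τ) ^ (r - 1))) *
        slopeMoment τ r α ^ (1 / r - 1)) := by ring
    _ = ε * (slopeMoment τ r α * slopeMoment τ r α ^ (1 / r - 1)) := by
        rw [key τ hτ.1, key _ (sub_pos.2 hτ.2), ← hs]
    _ = _ := by rw [Real.rpow_sub_one hH.ne']; field_simp

theorem mean_nonneg {N : ℕ} {a : Fin N → ℝ} (h0 : ∀ j, 0 ≤ a j) : 0 ≤ (∑ j, a j) / N :=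
  div_nonneg (Finset.sum_nonneg fun j _ => h0 j) N.cast_nonneg

theorem mean_le_one {N : ℕ} {a : Fin N → ℝ} (h1 : ∀ j, a j ≤ 1) : (∑ j, a j) / N ≤ 1 := by
  refine div_le_one_of_le₀ ?_ N.cast_nonneg
  calc ∑ j, a j ≤ ∑ _j : Fin N, (1 : ℝ) := Finset.sum_le_sum fun j _ => h1 j
    _ = N := by simp

theorem eLpNorm_displacementCoupling_le {N : ℕ} (hN : 0 < N) (y : Fin N → ℝ) {τ : ℝ}
    (hτ : τ ∈ Set.Ioo (0 : ℝ) 1) {ε : ℝ} (hε : 0 ≤ ε) {p q : ℝ≥0∞} (hp : 1 < p)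
    (hpq : 1 / p + 1 / q = 1) {a : Fin N → ℝ} (h0 : ∀ j, 0 ≤ a j) (h1 : ∀ j, a j ≤ 1) :
    eLpNorm (fun z : ℝ × ℝ => z.1 - z.2) p (displacementCoupling y a
      (ε * τ ^ (q.toReal - 1) * slopeMoment τ q.toReal ((∑ j, a j) / N) ^ (1 / q.toReal - 1))
      (ε * (1 - τ) ^ (q.toReal - 1) *
        slopeMoment τ q.toReal ((∑ j, a j) / N) ^ (1 / q.toReal - 1))) ≤ ENNReal.ofReal ε := by
  rcases eq_top_or_holderConjugate hp hpq with ⟨rfl, hq⟩ | ⟨hp', hc⟩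
  · rw [eLpNorm_exponent_top, hq]
    refine eLpNormEssSup_le_of_ae_bound ?_
    filter_upwards [ae_displacementCoupling y a
      (ε * τ ^ ((1 : ℝ) - 1) * slopeMoment τ 1 ((∑ j, a j) / N) ^ (1 / (1 : ℝ) - 1))
      (ε * (1 - τ) ^ ((1 : ℝ) - 1) * slopeMoment τ 1 ((∑ j, a j) / N) ^ (1 / (1 : ℝ) - 1))]
      with z hz
    -- For `r = 1` all the exponents vanish, so both displacements have size `ε`.
    rcases hz with hz | hz <;> rw [hz] <;> simp [abs_of_nonneg hε]
  · have hp0 : p ≠ 0 := (zero_lt_one.trans hp).ne'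
    rw [eLpNorm_le_ofReal_iff hp0 hp' hε,
      lintegral_displacementCoupling y h0 h1 _ _ fun z => Real.rpow_nonneg (abs_nonneg _) _]
    refine ENNReal.ofReal_le_ofReal (le_of_eq ?_)
    rw [← displacement_moment hc hτ hε (mean_nonneg h0) (mean_le_one h1)]
    simp only [add_sub_cancel_left, sub_sub_cancel_left, abs_neg]
    have hN' : (N : ℝ) ≠ 0 := by exact_mod_cast hN.ne'
    rw [Finset.sum_add_distrib, ← Finset.sum_mul, ← Finset.sum_mul, Finset.sum_sub_distrib]
    simp only [Finset.sum_const, Finset.card_univ, Fintype.card_fin, nsmul_eq_mul, mul_one]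
    field_simp

/-- Every random slope, given by its conditional probabilities `a j`, bounds the worst-case loss
from below. -/
theorem le_robustCheckLoss {N : ℕ} (hN : 0 < N) (y : Fin N → ℝ) {τ : ℝ}
    (hτ : τ ∈ Set.Ioo (0 : ℝ) 1) {ε : ℝ} (hε : 0 ≤ ε) {p q : ℝ≥0∞} (hp : 1 < p)
    (hpq : 1 / p + 1 / q = 1) {a : Fin N → ℝ} (h0 : ∀ j, 0 ≤ a j) (h1 : ∀ j, a j ≤ 1) (x : ℝ) :
    ENNReal.ofReal ((∑ j, (a j - (1 - τ)) * (y j - x)) / N +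
        ε * slopeMoment τ q.toReal ((∑ j, a j) / N) ^ (1 / q.toReal)) ≤
      robustCheckLoss p τ ε (empiricalLaw y) x := by
  have hgain := displacement_gain (r := q.toReal) hτ ε (mean_nonneg h0) (mean_le_one h1)
  have hnorm := eLpNorm_displacementCoupling_le hN y hτ hε hp hpq h0 h1
  set u := ε * τ ^ (q.toReal - 1) *
    slopeMoment τ q.toReal ((∑ j, a j) / N) ^ (1 / q.toReal - 1)
  set v := ε * (1 - τ) ^ (q.toReal - 1) *
    slopeMoment τ q.toReal ((∑ j, a j) / N) ^ (1 / q.toReal - 1)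
  have hsnd := displacementCoupling_snd hN y h0 h1 u v
  have := isProbabilityMeasure_empiricalLaw hN y
  have := isProbabilityMeasure_of_snd hsnd
  have hmem : (displacementCoupling y a u v).fst ∈ wassersteinBall p (empiricalLaw y) ε :=
    ⟨inferInstance, (iInf₂_le (displacementCoupling y a u v) ⟨rfl, hsnd⟩).trans hnorm⟩
  refine le_trans ?_ (le_iSup₂ (f := fun ν _ => expectedCheckLoss τ ν x) _ hmem)
  unfold expectedCheckLoss
  rw [Measure.fst, lintegral_map (measurable_ofReal_checkLoss_sub τ x) measurable_fst,
    lintegral_displacementCoupling y h0 h1 u v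
      (g := fun z => checkLoss τ (z.1 - x)) fun z => checkLoss_nonneg hτ.1.le hτ.2.le _]
  refine ENNReal.ofReal_le_ofReal ?_
  have hN' : (0 : ℝ) < N := by exact_mod_cast hN
  rw [← hgain]
  have hsum : (∑ j, (a j - (1 - τ)) * (y j - x)) / N + ((∑ j, a j) / N * (τ * u) +
      (1 - (∑ j, a j) / N) * ((1 - τ) * v)) =
      (∑ j, (a j * (τ * (y j + u - x)) + (1 - a j) * ((τ - 1) * (y j - v - x)))) / N := by
    have : ∀ j, a j * (τ * (y j + u - x)) + (1 - a j) * ((τ - 1) * (y j - v - x)) =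
        (a j - (1 - τ)) * (y j - x) + (a j * (τ * u) + (1 - a j) * ((1 - τ) * v)) := fun j => by
      ring
    simp only [this]
    rw [Finset.sum_add_distrib, Finset.sum_add_distrib, ← Finset.sum_mul, ← Finset.sum_mul,
      Finset.sum_sub_distrib (f := fun _ => (1 : ℝ))]
    simp only [Finset.sum_const, Finset.card_univ, Fintype.card_fin, nsmul_eq_mul, mul_one]
    field_simp
  rw [hsum]
  gcongr with j _
  · exact h0 j
  · exact mul_le_checkLoss _ _
  · exact sub_nonneg.2 (h1 j)
  · exact sub_one_mul_le_checkLoss _ _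

/-! ### The location correction and the upper bound -/

/-- The location correction for radius one. -/
noncomputable def unitCorrection (τ r : ℝ) : ℝ :=
  1 / r * (τ ^ r - (1 - τ) ^ r) * slopeMoment τ r (1 - τ) ^ (1 / r - 1)

theorem slopeMoment_one_sub (τ r : ℝ) :
    slopeMoment τ r (1 - τ) = τ ^ r * (1 - τ) + τ * (1 - τ) ^ r := by
  unfold slopeMoment
  ring

theorem correctionConst_eq {p q : ℝ≥0∞} (hp : 1 < p) (hpq : 1 / p + 1 / q = 1) (τ : ℝ) :
    correctionConst p q τ = slopeMoment τ q.toReal (1 - τ) ^ (1 / q.toReal) := by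
  rw [slopeMoment_one_sub]
  rcases eq_top_or_holderConjugate hp hpq with ⟨rfl, hq⟩ | ⟨hp', -⟩
  · rw [correctionConst, if_pos rfl, hq]
    simp only [Real.rpow_one, one_div, inv_one]
    ring
  · rw [correctionConst, if_neg hp']

theorem toReal_pos_of_conjugate {p q : ℝ≥0∞} (hp : 1 < p) (hpq : 1 / p + 1 / q = 1) :
    0 < q.toReal := by
  rcases eq_top_or_holderConjugate hp hpq with ⟨-, hq⟩ | ⟨-, hc⟩
  · rw [hq]; exact one_pos
  · exact hc.symm.pos

theorem locationCorrection_eq {p q : ℝ≥0∞} (hp : 1 < p) (hpq : 1 / p + 1 / q = 1) {τ : ℝ}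
    (hτ : τ ∈ Set.Ioo (0 : ℝ) 1) (ε : ℝ) :
    locationCorrection p q τ ε = ε * unitCorrection τ q.toReal := by
  have hr := toReal_pos_of_conjugate hp hpq
  have hH := slopeMoment_pos hτ q.toReal (sub_nonneg.2 hτ.2.le) (by linarith [hτ.1])
  rw [locationCorrection, unitCorrection, correctionConst_eq hp hpq, ← Real.rpow_mul hH.le]
  have : 1 / q.toReal * (1 - q.toReal) = 1 / q.toReal - 1 := by field_simp
  rw [this]
  ring

theorem checkLoss_sub_unitCorrection_le_of_abs_le_one {τ w : ℝ} (hτ : τ ∈ Set.Ioo (0 : ℝ) 1)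
    (hw : |w| ≤ 1) :
    checkLoss τ (w - unitCorrection τ 1) ≤ slopeMoment τ 1 (1 - τ) ^ (1 / (1 : ℝ)) := by
  obtain ⟨hw1, hw2⟩ := abs_le.1 hw
  simp only [unitCorrection, slopeMoment, Real.rpow_one, div_one, sub_self, Real.rpow_zero]
  rw [checkLoss_le_iff]
  constructor <;> nlinarith [hτ.1, hτ.2]

/-- Young's inequality bounds each of the two lines by a constant plus a common multiple of `|w| ^
P`. The shift `unitCorrection` is what makes the two constants agree. -/
theorem checkLoss_sub_unitCorrection_le {P r τ : ℝ} (h : P.HolderConjugate r)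
    (hτ : τ ∈ Set.Ioo (0 : ℝ) 1) (w : ℝ) :
    checkLoss τ (w - unitCorrection τ r) ≤
      slopeMoment τ r (1 - τ) ^ (1 / r) / r + slopeMoment τ r (1 - τ) ^ (1 / r) / P * |w| ^ P := by
  have hr := h.symm.pos
  have hP := h.pos
  have hτ' := sub_pos.2 hτ.2
  have hH := slopeMoment_pos hτ r hτ'.le (by linarith [hτ.1])
  have hHe := slopeMoment_one_sub τ r
  unfold unitCorrection
  set H := slopeMoment τ r (1 - τ)
  set k := H ^ (1 / r - 1) with hk
  have hkpos : 0 < k := Real.rpow_pos_of_pos hH _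
  have hc : H ^ (1 / r) = k * H := by
    rw [hk, Real.rpow_sub_one hH.ne']; field_simp
  have hkk : k ^ (-(P / r)) = k * H := by
    have e : (1 / r - 1) * (-(P / r)) = 1 / r := by
      have := h.inv_add_inv_eq_one
      have h3 : 1 / r - 1 = -P⁻¹ := by rw [one_div]; linarith
      rw [h3]; field_simp
    rw [hk, ← Real.rpow_mul hH.le, e, hc]
  have young (t : ℝ) (ht : 0 < t) : t * |w| ≤ t ^ r * k / r + k * H / P * |w| ^ P := by
    -- The powers of `k` cancel in the product and make the coefficient of `|w| ^ P` independent of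
    -- `t`, by `hkk`.
    have := Real.young_inequality_of_nonneg (a := t * k ^ (1 / r)) (b := |w| * k ^ (-(1 / r)))
      (by positivity) (by positivity) h.symm
    rw [Real.mul_rpow ht.le (by positivity), Real.mul_rpow (abs_nonneg _) (by positivity),
      ← Real.rpow_mul hkpos.le, ← Real.rpow_mul hkpos.le, one_div_mul_cancel hr.ne',
      Real.rpow_one] at this
    have e : -(1 / r) * P = -(P / r) := by ring
    rw [e, hkk] at this
    have e2 : t * k ^ (1 / r) * (|w| * k ^ (-(1 / r))) = t * |w| := by
      rw [Real.rpow_neg hkpos.le]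
      have : k ^ (1 / r) ≠ 0 := by positivity
      field_simp
    rw [e2] at this
    calc _ ≤ _ := this
      _ = _ := by ring
  rw [hc, checkLoss_le_iff]
  have y1 := young τ hτ.1
  have y2 := young (1 - τ) hτ'
  have w1 := mul_le_mul_of_nonneg_left (le_abs_self w) hτ.1.le
  have w2 := mul_le_mul_of_nonneg_left (neg_le_abs w) hτ'.le
  have c1 : τ ^ r * k / r - τ * (1 / r * (τ ^ r - (1 - τ) ^ r) * k) = k * H / r := by
    rw [hHe]; ring
  have c2 : (1 - τ) ^ r * k / r + (1 - τ) * (1 / r * (τ ^ r - (1 - τ) ^ r) * k) = k * H / r := by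
    rw [hHe]; ring
  constructor <;> linarith

theorem lintegral_checkLoss_displacement_le {π : Measure (ℝ × ℝ)} [IsProbabilityMeasure π] {τ : ℝ}
    (hτ : τ ∈ Set.Ioo (0 : ℝ) 1) {ε : ℝ} (hε : 0 < ε) {p q : ℝ≥0∞} (hp : 1 < p)
    (hpq : 1 / p + 1 / q = 1)
    (hπ : eLpNorm (fun z : ℝ × ℝ => z.1 - z.2) p π ≤ ENNReal.ofReal ε) :
    ∫⁻ z, ENNReal.ofReal (checkLoss τ (z.1 - z.2 - ε * unitCorrection τ q.toReal)) ∂π ≤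
      ENNReal.ofReal (ε * slopeMoment τ q.toReal (1 - τ) ^ (1 / q.toReal)) := by
  have hH := slopeMoment_pos hτ q.toReal (sub_nonneg.2 hτ.2.le) (by linarith [hτ.1])
  have hscale (d s : ℝ) : checkLoss τ (d - ε * s) = ε * checkLoss τ (d / ε - s) := by
    rw [← checkLoss_mul hε.le]
    congr 1
    field_simp
  simp only [hscale]
  rcases eq_top_or_holderConjugate hp hpq with ⟨rfl, hq⟩ | ⟨hp', hc⟩
  · rw [hq]
    rw [eLpNorm_exponent_top] at hπ
    calc _ ≤ ∫⁻ _, ENNReal.ofReal (ε * slopeMoment τ 1 (1 - τ) ^ (1 / (1 : ℝ))) ∂π := by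
          refine lintegral_mono_ae ?_
          filter_upwards [enorm_ae_le_eLpNormEssSup (fun z : ℝ × ℝ => z.1 - z.2) π] with z hz
          have hz' := hz.trans hπ
          rw [← ofReal_norm, Real.norm_eq_abs, ENNReal.ofReal_le_ofReal_iff hε.le] at hz'
          refine ENNReal.ofReal_le_ofReal (mul_le_mul_of_nonneg_left ?_ hε.le)
          refine checkLoss_sub_unitCorrection_le_of_abs_le_one hτ ?_
          rw [abs_div, abs_of_pos hε]
          exact div_le_one_of_le₀ hz' hε.le
      _ = _ := by simp
  · have hp0 : p ≠ 0 := (zero_lt_one.trans hp).ne'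
    rw [eLpNorm_le_ofReal_iff hp0 hp' hε.le] at hπ
    set c := slopeMoment τ q.toReal (1 - τ) ^ (1 / q.toReal)
    have hcpos : 0 < c := Real.rpow_pos_of_pos hH _
    have hP := hc.pos
    have hr := hc.symm.pos
    have hεP : 0 < ε ^ p.toReal := Real.rpow_pos_of_pos hε _
    calc _ ≤ ∫⁻ z, (ENNReal.ofReal (ε * (c / q.toReal)) +
            ENNReal.ofReal (ε * (c / p.toReal) / ε ^ p.toReal) *
              ENNReal.ofReal (|z.1 - z.2| ^ p.toReal)) ∂π := by
          refine lintegral_mono fun z => ?_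
          rw [← ENNReal.ofReal_mul (by positivity),
            ← ENNReal.ofReal_add (by positivity) (by positivity)]
          refine ENNReal.ofReal_le_ofReal ?_
          have := checkLoss_sub_unitCorrection_le hc hτ ((z.1 - z.2) / ε)
          rw [abs_div, abs_of_pos hε, Real.div_rpow (abs_nonneg _) hε.le] at this
          calc _ ≤ ε * _ := mul_le_mul_of_nonneg_left this hε.le
            _ = _ := by ring
      _ = ENNReal.ofReal (ε * (c / q.toReal)) +
            ENNReal.ofReal (ε * (c / p.toReal) / ε ^ p.toReal) *
              ∫⁻ z, ENNReal.ofReal (|z.1 - z.2| ^ p.toReal) ∂π := by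
          rw [lintegral_add_left measurable_const, lintegral_const, measure_univ, mul_one,
            lintegral_const_mul]
          fun_prop
      _ ≤ ENNReal.ofReal (ε * (c / q.toReal)) +
            ENNReal.ofReal (ε * (c / p.toReal) / ε ^ p.toReal) *
              ENNReal.ofReal (ε ^ p.toReal) := by gcongr
      _ = _ := by
          rw [← ENNReal.ofReal_mul (by positivity),
            ← ENNReal.ofReal_add (by positivity) (by positivity)]
          congr 1
          have := hc.inv_add_inv_eq_one
          rw [div_mul_cancel₀ _ hεP.ne']
          calc _ = ε * c * (p.toReal⁻¹ + q.toReal⁻¹) := by ring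
            _ = _ := by rw [this, mul_one]

theorem robustCheckLoss_add_correction_le {μ : Measure ℝ} [IsProbabilityMeasure μ] {τ : ℝ}
    (hτ : τ ∈ Set.Ioo (0 : ℝ) 1) {ε : ℝ} (hε : 0 ≤ ε) {p q : ℝ≥0∞} (hp : 1 < p)
    (hpq : 1 / p + 1 / q = 1) (x : ℝ) :
    robustCheckLoss p τ ε μ (x + ε * unitCorrection τ q.toReal) ≤
      expectedCheckLoss τ μ x +
        ENNReal.ofReal (ε * slopeMoment τ q.toReal (1 - τ) ^ (1 / q.toReal)) := by
  refine iSup₂_le fun ν ⟨_, hν⟩ => ?_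
  set s := unitCorrection τ q.toReal
  set c := slopeMoment τ q.toReal (1 - τ) ^ (1 / q.toReal)
  -- The slack `δ` yields a coupling without attainment of the infimum, and a positive radius even
  -- when `ε = 0`.
  have key (δ : ℝ) (hδ : 0 < δ) : expectedCheckLoss τ ν (x + ε * s) ≤
      expectedCheckLoss τ μ x + ENNReal.ofReal ((ε + δ) * c) + ENNReal.ofReal (δ * |s|) := by
    have hlt : wassersteinDist p ν μ < ENNReal.ofReal (ε + δ) :=
      hν.trans_lt ((ENNReal.ofReal_lt_ofReal_iff (by linarith)).2 (by linarith))
    obtain ⟨π, hlt⟩ := iInf_lt_iff.1 hlt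
    obtain ⟨⟨hfst, hsnd⟩, hπ⟩ := iInf_lt_iff.1 hlt
    have := isProbabilityMeasure_of_snd hsnd
    unfold expectedCheckLoss
    rw [← hfst, ← hsnd, Measure.fst, Measure.snd,
      lintegral_map (measurable_ofReal_checkLoss_sub τ _) measurable_fst,
      lintegral_map (measurable_ofReal_checkLoss_sub τ _) measurable_snd]
    have hρ := checkLoss_nonneg hτ.1.le hτ.2.le
    have hm := measurable_checkLoss τ
    calc _ ≤ ∫⁻ z, (ENNReal.ofReal (checkLoss τ (z.2 - x)) +
            ENNReal.ofReal (checkLoss τ (z.1 - z.2 - (ε + δ) * s)) +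
            ENNReal.ofReal (δ * |s|)) ∂π := by
          refine lintegral_mono fun z => ?_
          rw [← ENNReal.ofReal_add (hρ _) (hρ _),
            ← ENNReal.ofReal_add (add_nonneg (hρ _) (hρ _)) (by positivity)]
          refine ENNReal.ofReal_le_ofReal ?_
          have e : z.1 - (x + ε * s) = (z.2 - x) + (z.1 - z.2 - (ε + δ) * s) + δ * s := by ring
          rw [e]
          have h1 := checkLoss_add_le τ ((z.2 - x) + (z.1 - z.2 - (ε + δ) * s)) (δ * s)
          have h2 := checkLoss_add_le τ (z.2 - x) (z.1 - z.2 - (ε + δ) * s)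
          have h3 := checkLoss_le_abs hτ.1.le hτ.2.le (δ * s)
          rw [abs_mul, abs_of_pos hδ] at h3
          linarith
      _ = ∫⁻ z, ENNReal.ofReal (checkLoss τ (z.2 - x)) ∂π +
            ∫⁻ z, ENNReal.ofReal (checkLoss τ (z.1 - z.2 - (ε + δ) * s)) ∂π +
            ENNReal.ofReal (δ * |s|) := by
          rw [lintegral_add_right _ measurable_const, lintegral_add_left, lintegral_const,
            measure_univ, mul_one]
          fun_prop
      _ ≤ _ := by
          gcongr
          exact lintegral_checkLoss_displacement_le hτ (by linarith) hp hpq hπ.le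
  have hcont : Continuous fun δ : ℝ => expectedCheckLoss τ μ x +
      ENNReal.ofReal ((ε + δ) * c) + ENNReal.ofReal (δ * |s|) :=
    (continuous_const.add (ENNReal.continuous_ofReal.comp (by fun_prop))).add
      (ENNReal.continuous_ofReal.comp (by fun_prop))
  have hlim := (hcont.tendsto 0).mono_left (nhdsWithin_le_nhds (s := Set.Ioi 0))
  simp only [add_zero, zero_mul, ENNReal.ofReal_zero] at hlim
  refine ge_of_tendsto hlim ?_
  filter_upwards [self_mem_nhdsWithin] with δ hδ using key δ hδ

/-! ### Sample quantiles -/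

/-- A sample quantile together with conditional slope probabilities certifying its optimality. -/
theorem exists_quantile_certificate {N : ℕ} (hN : 0 < N) (y : Fin N → ℝ) {τ : ℝ}
    (hτ : τ ∈ Set.Ioo (0 : ℝ) 1) :
    ∃ (x : ℝ) (a : Fin N → ℝ), (∀ j, 0 ≤ a j) ∧ (∀ j, a j ≤ 1) ∧ (∑ j, a j) / N = 1 - τ ∧
      ∀ j, (a j - (1 - τ)) * (y j - x) = checkLoss τ (y j - x) := by
  have : Nonempty (Fin N) := ⟨⟨0, hN⟩⟩
  have hN' : (0 : ℝ) < N := by exact_mod_cast hN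
  -- The quantile is the largest sample value whose closed upper tail has mass at least `1 - τ`.
  let S : Finset (Fin N) := Finset.univ.filter fun i =>
    (1 - τ) * N ≤ ∑ j, if y i ≤ y j then (1 : ℝ) else 0
  have hS : S.Nonempty := by
    obtain ⟨i, hi⟩ := Finite.exists_min y
    refine ⟨i, Finset.mem_filter.2 ⟨Finset.mem_univ _, ?_⟩⟩
    simp only [hi, if_true, Finset.sum_const, Finset.card_univ, Fintype.card_fin, nsmul_eq_mul,
      mul_one]
    nlinarith [hτ.1]
  obtain ⟨i, hi, hmax⟩ := S.exists_max_image y hS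
  have hge : (1 - τ) * N ≤ ∑ j, if y i ≤ y j then (1 : ℝ) else 0 := (Finset.mem_filter.1 hi).2
  -- The open upper tail is contained in the closed tail of the next larger sample value, which
  -- fails the condition.
  have hgt : ∑ j, (if y i < y j then (1 : ℝ) else 0) ≤ (1 - τ) * N := by
    by_cases hne : (Finset.univ.filter fun k => y i < y k).Nonempty
    · obtain ⟨k, hk, hmin⟩ := Finset.exists_min_image _ y hne
      have hk' : y i < y k := (Finset.mem_filter.1 hk).2
      have hkS : k ∉ S := fun h => absurd (hmax k h) (not_le.2 hk')
      have hlt : ∑ j, (if y k ≤ y j then (1 : ℝ) else 0) < (1 - τ) * N := by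
        by_contra hcon
        exact hkS (Finset.mem_filter.2 ⟨Finset.mem_univ _, not_lt.1 hcon⟩)
      refine le_trans (Finset.sum_le_sum fun j _ => ?_) hlt.le
      by_cases hj : y i < y j
      · rw [if_pos hj, if_pos (hmin j (Finset.mem_filter.2 ⟨Finset.mem_univ _, hj⟩))]
      · rw [if_neg hj]
        split_ifs <;> norm_num
    · have : ∀ j, ¬ y i < y j := fun j hj => hne ⟨j, Finset.mem_filter.2 ⟨Finset.mem_univ _, hj⟩⟩
      simp only [this, if_false, Finset.sum_const_zero]
      exact mul_nonneg (sub_nonneg.2 hτ.2.le) hN'.le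
  set A := ∑ j, if y i ≤ y j then (1 : ℝ) else 0
  set B := ∑ j, if y i < y j then (1 : ℝ) else 0
  -- The fraction `θ` splits the atom at `y i` so that the mean is exactly `1 - τ`; at that atom the
  -- loss vanishes for any slope.
  obtain ⟨θ, hθ0, hθ1, hθ⟩ : ∃ θ : ℝ, 0 ≤ θ ∧ θ ≤ 1 ∧ θ * A + (1 - θ) * B = (1 - τ) * N := by
    have hmem : (1 - τ) * N ∈ segment ℝ B A := by
      rw [segment_eq_Icc (hgt.trans hge)]
      exact ⟨hgt, hge⟩
    obtain ⟨b, θ, hb, hθ, hbθ, h⟩ := hmem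
    refine ⟨θ, hθ, by linarith, ?_⟩
    rw [← h, smul_eq_mul, smul_eq_mul, ← hbθ]
    ring
  refine ⟨y i, fun j => θ * (if y i ≤ y j then 1 else 0) + (1 - θ) * (if y i < y j then 1 else 0),
    fun j => ?_, fun j => ?_, ?_, fun j => ?_⟩
  · dsimp only
    split_ifs <;> nlinarith
  · dsimp only
    split_ifs <;> nlinarith
  · rw [Finset.sum_add_distrib, ← Finset.mul_sum, ← Finset.mul_sum, hθ]
    field_simp
  · rw [checkLoss_eq_indicator]
    rcases lt_trichotomy (y i) (y j) with h | h | h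
    · simp [h, h.le]
    · simp [h]
    · simp [h.not_ge, h.not_gt]

/-! ### First-order condition at a robust minimizer -/

theorem hasDerivAt_slopeMoment_rpow {τ : ℝ} (hτ : τ ∈ Set.Ioo (0 : ℝ) 1) (r d : ℝ) :
    HasDerivAt (fun t => slopeMoment τ r (1 - τ + t * d) ^ (1 / r)) (d * unitCorrection τ r) 0 := by
  have hH := slopeMoment_pos hτ r (sub_nonneg.2 hτ.2.le) (by linarith [hτ.1])
  have hlin : HasDerivAt (fun t => slopeMoment τ r (1 - τ + t * d))
      (d * (τ ^ r - (1 - τ) ^ r)) 0 := by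
    have e : (fun t => slopeMoment τ r (1 - τ + t * d)) =
        fun t => t * (d * (τ ^ r - (1 - τ) ^ r)) + slopeMoment τ r (1 - τ) := by
      funext t
      unfold slopeMoment
      ring
    rw [e]
    simpa using ((hasDerivAt_id (0 : ℝ)).mul_const (d * (τ ^ r - (1 - τ) ^ r))).add_const
      (slopeMoment τ r (1 - τ))
  have := hlin.rpow_const (p := 1 / r) (Or.inl (by simpa using hH.ne'))
  convert this using 1
  simp only [unitCorrection, zero_mul, add_zero]
  ring

theorem deriv_nonpos_of_forall_le {g : ℝ → ℝ} {g' : ℝ} (hg : HasDerivAt g g' 0)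
    (h : ∀ t, 0 < t → t ≤ 1 → g t ≤ g 0) : g' ≤ 0 := by
  have hs := hg.tendsto_slope.mono_left
    (nhdsWithin_mono 0 (fun t (ht : t ∈ Set.Ioi (0 : ℝ)) => ne_of_gt ht))
  refine le_of_tendsto hs ?_
  filter_upwards [Ioc_mem_nhdsGT (zero_lt_one' ℝ)] with t ht
  rw [slope_def_field]
  exact div_nonpos_of_nonpos_of_nonneg (sub_nonpos.2 (h t ht.1 ht.2)) (by linarith [ht.1])

theorem mean_slope_mul_sub {N : ℕ} (hN : 0 < N) (y a : Fin N → ℝ) (τ x : ℝ) :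
    (∑ j, (a j - (1 - τ)) * (y j - x)) / N =
      (∑ j, (a j - (1 - τ)) * y j) / N - x * ((∑ j, a j) / N - (1 - τ)) := by
  have hN' : (N : ℝ) ≠ 0 := by exact_mod_cast hN.ne'
  simp only [mul_sub]
  rw [Finset.sum_sub_distrib, ← Finset.sum_mul, Finset.sum_sub_distrib]
  simp only [Finset.sum_const, Finset.card_univ, Fintype.card_fin, nsmul_eq_mul]
  field_simp

theorem sampleCheckLoss_nonneg {N : ℕ} (y : Fin N → ℝ) {τ : ℝ} (h0 : 0 ≤ τ) (h1 : τ ≤ 1)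
    (x : ℝ) : 0 ≤ sampleCheckLoss y τ x :=
  div_nonneg (Finset.sum_nonneg fun _ _ => checkLoss_nonneg h0 h1 _) N.cast_nonneg

theorem mem_argminSet_expectedCheckLoss_iff {N : ℕ} (hN : 0 < N) (y : Fin N → ℝ) {τ : ℝ}
    (h0 : 0 ≤ τ) (h1 : τ ≤ 1) {x : ℝ} :
    x ∈ argminSet (expectedCheckLoss τ (empiricalLaw y)) ↔
      ∀ x', sampleCheckLoss y τ x ≤ sampleCheckLoss y τ x' := by
  simp only [argminSet, Set.mem_ofPred_eq, isMinOn_univ_iff,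
    expectedCheckLoss_empiricalLaw hN y h0 h1]
  exact forall_congr' fun x' => ENNReal.ofReal_le_ofReal_iff (sampleCheckLoss_nonneg y h0 h1 x')

theorem sampleCheckLoss_sub_correction_le {N : ℕ} (hN : 0 < N) (y : Fin N → ℝ) {τ : ℝ}
    (hτ : τ ∈ Set.Ioo (0 : ℝ) 1) {ε : ℝ} (hε : 0 ≤ ε) {p q : ℝ≥0∞} (hp : 1 < p)
    (hpq : 1 / p + 1 / q = 1) {a : Fin N → ℝ} (h0 : ∀ j, 0 ≤ a j) (h1 : ∀ j, a j ≤ 1)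
    (ha : (∑ j, a j) / N = 1 - τ) (hL : 0 ≤ (∑ j, (a j - (1 - τ)) * y j) / N) {x : ℝ}
    (hx : robustCheckLoss p τ ε (empiricalLaw y) x ≤
      ENNReal.ofReal ((∑ j, (a j - (1 - τ)) * y j) / N +
        ε * slopeMoment τ q.toReal (1 - τ) ^ (1 / q.toReal))) :
    sampleCheckLoss y τ (x - ε * unitCorrection τ q.toReal) ≤
      (∑ j, (a j - (1 - τ)) * y j) / N := by
  set r := q.toReal
  set s := unitCorrection τ r
  have hH := slopeMoment_pos hτ r (sub_nonneg.2 hτ.2.le) (by linarith [hτ.1])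
  -- `b` selects the slope active at `x - ε * s`, so its linear bound equals the loss there.
  let b : Fin N → ℝ := fun j => if 0 ≤ y j - (x - ε * s) then 1 else 0
  have hb0 : ∀ j, 0 ≤ b j := fun j => by dsimp only [b]; split_ifs <;> norm_num
  have hb1 : ∀ j, b j ≤ 1 := fun j => by dsimp only [b]; split_ifs <;> norm_num
  have hbloss : sampleCheckLoss y τ (x - ε * s) = (∑ j, (b j - (1 - τ)) * y j) / N -
      (x - ε * s) * ((∑ j, b j) / N - (1 - τ)) := by
    rw [← mean_slope_mul_sub hN, sampleCheckLoss]
    simp only [checkLoss_eq_indicator, b]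
  set La := (∑ j, (a j - (1 - τ)) * y j) / N with hLa
  set Lb := (∑ j, (b j - (1 - τ)) * y j) / N with hLb
  set d := (∑ j, b j) / N - (1 - τ) with hd
  -- Up to a constant, this is the lower bound along `(1 - t) a + t b`. By `hx` it is largest at `t
  -- = 0`, and its derivative there is `sampleCheckLoss y τ (x - ε * s) - La`.
  have hg := ((hasDerivAt_id (0 : ℝ)).mul_const (Lb - La - x * d)).add
    ((hasDerivAt_slopeMoment_rpow hτ r d).const_mul ε)
  have hle := deriv_nonpos_of_forall_le hg fun t ht0 ht1 => by
    have ht1' : 0 ≤ 1 - t := sub_nonneg.2 ht1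
    have hm0 : ∀ j, 0 ≤ (1 - t) * a j + t * b j := fun j =>
      add_nonneg (mul_nonneg ht1' (h0 j)) (mul_nonneg ht0.le (hb0 j))
    have hm1 : ∀ j, (1 - t) * a j + t * b j ≤ 1 := fun j => by
      have := mul_le_mul_of_nonneg_left (h1 j) ht1'
      have := mul_le_mul_of_nonneg_left (hb1 j) ht0.le
      linarith
    have hmean : (∑ j, ((1 - t) * a j + t * b j)) / N = 1 - τ + t * d := by
      rw [Finset.sum_add_distrib, ← Finset.mul_sum, ← Finset.mul_sum, add_div, mul_div_assoc,
        mul_div_assoc, ha, hd]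
      ring
    have hL' : (∑ j, ((1 - t) * a j + t * b j - (1 - τ)) * y j) / N = (1 - t) * La + t * Lb := by
      rw [hLa, hLb, ← mul_div_assoc, ← mul_div_assoc, ← add_div, Finset.mul_sum, Finset.mul_sum,
        ← Finset.sum_add_distrib]
      congr 1
      exact Finset.sum_congr rfl fun j _ => by ring
    have hlow := (le_robustCheckLoss hN y hτ hε hp hpq hm0 hm1 x).trans hx
    rw [mean_slope_mul_sub hN, hL', hmean, ENNReal.ofReal_le_ofReal_iff (by positivity)] at hlow
    simp only [Pi.add_apply, id, zero_mul, add_zero]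
    linarith
  rw [hbloss]
  linarith

theorem theorem1 (N : ℕ) (hN : 0 < N) (y : Fin N → ℝ) (τ : ℝ) (hτ : τ ∈ Set.Ioo (0 : ℝ) 1)
    (ε : ℝ) (hε : 0 ≤ ε) (p q : ℝ≥0∞) (hp : 1 < p) (hpq : 1 / p + 1 / q = 1) :
    (argminSet (robustCheckLoss p τ ε (empiricalLaw y))).Nonempty ∧
      ∀ x : ℝ, x ∈ argminSet (robustCheckLoss p τ ε (empiricalLaw y)) ↔
        ∃ x₀ ∈ argminSet (expectedCheckLoss τ (empiricalLaw y)),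
          x = x₀ + locationCorrection p q τ ε := by
  have hτ0 := hτ.1.le
  have hτ1 := hτ.2.le
  have hprob := isProbabilityMeasure_empiricalLaw hN y
  obtain ⟨xq, a, h0, h1, ha, hxq⟩ := exists_quantile_certificate hN y hτ
  have hmean (x : ℝ) : (∑ j, (a j - (1 - τ)) * (y j - x)) / N =
      (∑ j, (a j - (1 - τ)) * y j) / N := by
    rw [mean_slope_mul_sub hN, ha, sub_self, mul_zero, sub_zero]
  have hval : sampleCheckLoss y τ xq = (∑ j, (a j - (1 - τ)) * y j) / N := by
    rw [← hmean xq, sampleCheckLoss]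
    simp only [hxq]
  have hlow (x : ℝ) : (∑ j, (a j - (1 - τ)) * y j) / N ≤ sampleCheckLoss y τ x := by
    rw [← hmean x, sampleCheckLoss]
    gcongr with j _
    exact convexCombination_mul_le_checkLoss (h0 j) (h1 j) _
  have hL0 := hval ▸ sampleCheckLoss_nonneg y hτ0 hτ1 xq
  have hH := slopeMoment_pos hτ q.toReal (sub_nonneg.2 hτ1) (by linarith)
  have hrlow (x : ℝ) : ENNReal.ofReal ((∑ j, (a j - (1 - τ)) * y j) / N +
      ε * slopeMoment τ q.toReal (1 - τ) ^ (1 / q.toReal)) ≤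
        robustCheckLoss p τ ε (empiricalLaw y) x := by
    have := le_robustCheckLoss hN y hτ hε hp hpq h0 h1 x
    rwa [hmean, ha] at this
  have hrup {x : ℝ} (hx : sampleCheckLoss y τ x ≤ (∑ j, (a j - (1 - τ)) * y j) / N) :
      robustCheckLoss p τ ε (empiricalLaw y) (x + ε * unitCorrection τ q.toReal) ≤
        ENNReal.ofReal ((∑ j, (a j - (1 - τ)) * y j) / N +
          ε * slopeMoment τ q.toReal (1 - τ) ^ (1 / q.toReal)) := by
    refine (robustCheckLoss_add_correction_le hτ hε hp hpq x).trans ?_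
    rw [expectedCheckLoss_empiricalLaw hN y hτ0 hτ1, ENNReal.ofReal_add hL0 (by positivity)]
    gcongr
  rw [locationCorrection_eq hp hpq hτ]
  simp only [mem_argminSet_expectedCheckLoss_iff hN y hτ0 hτ1]
  simp only [argminSet, Set.mem_ofPred_eq, isMinOn_univ_iff]
  refine ⟨⟨xq + ε * unitCorrection τ q.toReal, fun x => (hrup hval.le).trans (hrlow x)⟩,
    fun x => ⟨fun hx => ?_, ?_⟩⟩
  · refine ⟨x - ε * unitCorrection τ q.toReal, fun x' => ?_, by ring⟩
    exact (sampleCheckLoss_sub_correction_le hN y hτ hε hp hpq h0 h1 ha hL0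
      ((hx _).trans (hrup hval.le))).trans (hlow x')
  · rintro ⟨x₀, hx₀, rfl⟩ x
    exact (hrup ((hx₀ xq).trans_eq hval)).trans (hrlow x)
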